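/- Let $(M,d)$ be a doubling metric space: there is $\kappa\in\mathbb N$ such that for all $x\in M$ and $r>0$ the open ball $B(x,2r)$ can be covered by at most $\kappa$ open balls of radius $r$. Let $I$ be a finite set with $\#I\ge 2$, let $I^*=\bigcup_{n\ge1}I^n$ be the set of finite (nonempty) words, and for a word $\mathtt i$ of length $|\mathtt i|\ge2$ let $\mathtt i^-$ be $\mathtt i$ with its last letter removed. Let $\{X_{\mathtt i}:\mathtt i\in I^*\}$ be a controlled Moran construction (CMC) in $M$, that is, a family of compact subsets of $M$ of positive diameter such that $X_{\mathtt i}\subset X_{\mathtt i^-}$ whenever $|\mathtt i|\ge2$, and such that for some constant $D\ge1$ * there is $n\ge1$ with $\max_{\mathtt i\in I^n}\operatorname{diam}(X_{\mathtt i})<D^{-1}$, and * $D^{-1}\le \dfrac{\operatorname{diam}(X_{\mathtt i\mathtt j})}{\operatorname{diam}(X_{\mathtt i})\operatorname{diam}(X_{\mathtt j})}\le D$ for all $\mathtt i,\mathtt j\in I^*$. Its limit set $E$ consists of the points $\pi(\omega)$, $\omega\in I^{\mathbb N}$, where $\{\pi(\omega)\}=\bigcap_{n\ge1}X_{\omega|_n}$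 and $\omega|_n$ is the initial word of $\omega$ of length $n$; its topological pressure is $P(t)=\lim_{n\to\infty}\frac1n\log\sum_{\mathtt i\in I^n}\operatorname{diam}(X_{\mathtt i})^t$ for $t\ge0$. For $r>0$ and $x\in E$ put $$Z(r)=\{\mathtt i\in I^*: |\mathtt i|\ge2,\ \operatorname{diam}(X_{\mathtt i})\le r<\operatorname{diam}(X_{\mathtt i^-})\},\qquad Z(x,r)=\{\mathtt i\in Z(r):X_{\mathtt i}\cap B(x,r)\neq\emptyset\}.$$ With $\operatorname{dist}(A,B)=\inf\{d(a,b):a\in A,\ b\in B\}$, assume that the construction is tractable: there is $C\ge1$ such that for every $r>0$ $$\operatorname{dist}(X_{\mathtt h\mathtt i},X_{\mathtt h\mathtt j})\le C\operatorname{diam}(X_{\mathtt h})\,r$$ whenever $\mathtt h\in I^*$, $\mathtt i,\mathtt j\in Z(r)$ and $\operatorname{dist}(X_{\mathtt i},X_{\mathtt j})\le r$. Let $t\ge0$ be such that $P(t)=0$. If the $t$-dimensional Hausdorff measure satisfies $\mathcal H^t(E)>0$, then the construction has the finite clustering property: $$\sup_{x\in E}\ \limsup_{r\downarrow0}\ \#Z(x,r)<\infty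 .$$ -/

import Mathlib

open Filter Topology MeasureTheory

namespace Moran

/-- Doubling metric space: for some `κ : ℕ`, every ball `B(x, 2r)` is covered by at most `κ`
balls of radius `r`. -/
def IsDoubling (M : Type*) [MetricSpace M] : Prop :=
  ∃ κ : ℕ, ∀ (x : M) (r : ℝ), 0 < r →
    ∃ s : Finset M, s.card ≤ κ ∧ Metric.ball x (2 * r) ⊆ ⋃ y ∈ s, Metric.ball y r

/-- `dist(A, B) = inf {d(a, b) : a ∈ A, b ∈ B}`. -/
noncomputable def setDist {M : Type*} [MetricSpace M] (A B : Set M) : ℝ :=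
  sInf (Set.image2 dist A B)

/-- The initial word `ω|_n` of length `n` of an infinite word `ω`. -/
def initialWord {I : Type*} (ω : ℕ → I) (n : ℕ) : List I :=
  List.ofFn (fun k : Fin n => ω k)

/-- Controlled Moran construction. The finite words over `I` are the nonempty lists; the value
of `X` at the empty list is never used, here and below. The word `i` without its last letter,
`i⁻ = i.dropLast`, is again a word when `i` has length at least `2`. -/
structure IsCMC {I M : Type*} [MetricSpace M] (X : List I → Set M) : Prop where
  isCompact : ∀ i : List I, i ≠ [] → IsCompact (X i)
  diam_pos : ∀ i : List I, i ≠ [] → 0 < Metric.diam (X i)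
  subset : ∀ i : List I, 2 ≤ i.length → X i ⊆ X i.dropLast
  control : ∃ D : ℝ, 1 ≤ D ∧
    (∃ n : ℕ, 1 ≤ n ∧ ∀ i : List I, i.length = n → Metric.diam (X i) < D⁻¹) ∧
    (∀ i j : List I, i ≠ [] → j ≠ [] →
      D⁻¹ ≤ Metric.diam (X (i ++ j)) / (Metric.diam (X i) * Metric.diam (X j)) ∧
      Metric.diam (X (i ++ j)) / (Metric.diam (X i) * Metric.diam (X j)) ≤ D)

/-- The limit set: all points `π(ω)`, where `{π(ω)} = ⋂_{n ≥ 1} X_{ω|_n}`. -/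
def limitSet {I M : Type*} (X : List I → Set M) : Set M :=
  {x | ∃ ω : ℕ → I, ⋂ n : ℕ, X (initialWord ω (n + 1)) = {x}}

/-- The topological pressure at `t` exists and equals `p`:
`lim_{n → ∞} (1/n) log ∑_{i ∈ I^n} diam(X_i)^t = p`. -/
def HasPressure {I M : Type*} [Fintype I] [MetricSpace M] (X : List I → Set M) (t p : ℝ) : Prop :=
  Tendsto
    (fun n : ℕ => (1 / (n : ℝ)) *
      Real.log (∑ i : Fin n → I, Metric.diam (X (List.ofFn i)) ^ t))
    atTop (𝓝 p)

/-- `Z(r)`: the words `i` with `diam(X_i) ≤ r < diam(X_{i⁻})`. -/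
def Z {I M : Type*} [MetricSpace M] (X : List I → Set M) (r : ℝ) : Set (List I) :=
  {i | 2 ≤ i.length ∧ Metric.diam (X i) ≤ r ∧ r < Metric.diam (X i.dropLast)}

/-- `Z(x, r)`: the words `i ∈ Z(r)` for which `X_i` meets the open ball `B(x, r)`. -/
def ZAt {I M : Type*} [MetricSpace M] (X : List I → Set M) (x : M) (r : ℝ) : Set (List I) :=
  {i | i ∈ Z X r ∧ (X i ∩ Metric.ball x r).Nonempty}

/-- Finite clustering property: `sup_{x ∈ E} limsup_{r ↓ 0} #Z(x, r) < ∞`. -/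
def FiniteClustering {I M : Type*} [MetricSpace M] (X : List I → Set M) : Prop :=
  (⨆ x ∈ limitSet X, limsup (fun r : ℝ => (ZAt X x r).encard) (𝓝[>] 0)) < (⊤ : ℕ∞)

/-- Tractability of a Moran construction. -/
def IsTractable {I M : Type*} [MetricSpace M] (X : List I → Set M) : Prop :=
  ∃ C : ℝ, 1 ≤ C ∧ ∀ r : ℝ, 0 < r → ∀ h i j : List I, h ≠ [] → i ∈ Z X r → j ∈ Z X r →
    setDist (X i) (X j) ≤ r →
    setDist (X (h ++ i)) (X (h ++ j)) ≤ C * Metric.diam (X h) * r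

end Moran

/-! A large cluster makes the limit set cheap to cover. The diameters are multiplicative up to a
constant, so at zero pressure the sums of `diam^t` over each level are bounded above and below.
Hence there is a mass `μ` on words, comparable with `diam^t` and superadditive over prefix-free sets
of extensions (`exists_mass`). Let `W ⊆ Z(r)` have pairwise close sets. By tractability, inside
every `X h` the sets `X (h ++ i)`, `i ∈ W`, lie in one set of diameter at most a constant times `r *
diam (X h)`. Its cost is of order `(r * diam (X h))^t`, while the mass it captures is of order `#W`
times that. The captured part is a fixed proportion of `μ h`, so repeating this in what is left
exhausts the mass, at cost `O(1/#W)` per unit mass. Thus `#W` times the Hausdorff measure of `E` is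
bounded (`exists_card_mul_hausdorffMeasure_le`). Positive measure bounds `#W`, and doubling splits
`Z(x, r)` into boundedly many such clusters (`exists_encard_ZAt_le`). -/

namespace Moran

/-! ### Sums over words -/

/-- The words of length `n`. -/
def words (I : Type*) [Fintype I] (n : ℕ) : Finset (List I) :=
  Finset.univ.map ⟨fun f : Fin n → I => List.ofFn f, List.ofFn_injective⟩

theorem mem_words {I : Type*} [Fintype I] {n : ℕ} {w : List I} :
    w ∈ words I n ↔ w.length = n := by
  simp only [words, Finset.mem_map, Finset.mem_univ, true_and, Function.Embedding.coeFn_mk]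
  constructor
  · rintro ⟨f, rfl⟩
    simp
  · rintro rfl
    exact ⟨w.get, List.ofFn_get w⟩

theorem sum_words {I : Type*} [Fintype I] (n : ℕ) (f : List I → ℝ) :
    ∑ w ∈ words I n, f w = ∑ i : Fin n → I, f (List.ofFn i) := by
  simp [words]

theorem words_nonempty {I : Type*} [Fintype I] [Nonempty I] (n : ℕ) : (words I n).Nonempty :=
  Finset.univ_nonempty.map

theorem sum_words_add {I : Type*} [Fintype I] (m n : ℕ) (f : List I → ℝ) :
    ∑ w ∈ words I (m + n), f w = ∑ u ∈ words I m, ∑ v ∈ words I n, f (u ++ v) := by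
  rw [← Finset.sum_product']
  refine Finset.sum_nbij' (fun w => (w.take m, w.drop m)) (fun p => p.1 ++ p.2) ?_ ?_ ?_ ?_ ?_
  · intro w hw
    simp only [Finset.mem_product, mem_words] at *
    simp [hw]
  · intro p hp
    simp only [Finset.mem_product, mem_words] at *
    simp [hp]
  · intro w _
    simp
  · rintro ⟨u, v⟩ hp
    simp only [Finset.mem_product, mem_words] at hp
    simp [← hp.1]
  · intro w _
    simp

open Classical in
/-- The sum of `f` over all words of length `n` that start with `h`. -/
noncomputable def extSum {I : Type*} [Fintype I] (f : List I → ℝ) (n : ℕ) (h : List I) : ℝ :=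
  ∑ w ∈ words I n with h <+: w, f w

theorem extSum_eq {I : Type*} [Fintype I] (f : List I → ℝ) (n : ℕ) (h : List I) :
    extSum f (h.length + n) h = ∑ v ∈ words I n, f (h ++ v) := by
  classical
  unfold extSum
  refine Finset.sum_nbij' (fun w => w.drop h.length) (fun v => h ++ v) ?_ ?_ ?_ ?_ ?_
  · intro w hw
    simp only [Finset.mem_filter, mem_words] at *
    simp [hw.1]
  · intro v hv
    simp only [Finset.mem_filter, mem_words] at *
    simp [hv]
  · intro w hw
    obtain ⟨v, rfl⟩ := (Finset.mem_filter.1 hw).2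
    simp
  · intro v _
    simp
  · intro w hw
    obtain ⟨v, rfl⟩ := (Finset.mem_filter.1 hw).2
    simp

/-- No word of `S` is a proper prefix of another one. -/
def PrefixFree {I : Type*} (S : Finset (List I)) : Prop :=
  ∀ i ∈ S, ∀ j ∈ S, i <+: j → i = j

/-- Two prefixes of one word are comparable, so prefix-freeness makes the sets of extensions of the
words `h ++ i` disjoint. -/
theorem sum_extSum_le {I : Type*} [Fintype I] {f : List I → ℝ} (hf : ∀ w, 0 ≤ f w) (n : ℕ)
    (h : List I) {S : Finset (List I)} (hS : PrefixFree S) :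
    ∑ i ∈ S, extSum f n (h ++ i) ≤ extSum f n h := by
  classical
  unfold extSum
  rw [← Finset.sum_biUnion]
  · refine Finset.sum_le_sum_of_subset_of_nonneg ?_ fun w _ _ => hf w
    intro w hw
    simp only [Finset.mem_biUnion, Finset.mem_filter] at *
    obtain ⟨i, -, hw, hi⟩ := hw
    exact ⟨hw, (List.prefix_append h i).trans hi⟩
  · intro i hi j hj hij
    refine Finset.disjoint_left.2 fun w hw hw' => hij ?_
    rcases List.prefix_or_prefix_of_prefix (Finset.mem_filter.1 hw).2
      (Finset.mem_filter.1 hw').2 with H | H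
    · exact hS i hi j hj ((List.prefix_append_right_inj h).1 H)
    · exact (hS j hj i hi ((List.prefix_append_right_inj h).1 H)).symm

/-! ### Zero pressure and the mass distribution -/

/-- A subadditive sequence with `u n / n → 0` is nonnegative. -/
theorem nonneg_of_subadditive_of_tendsto_zero {u : ℕ → ℝ} (hu : ∀ m n, u (m + n) ≤ u m + u n)
    (hlim : Tendsto (fun n : ℕ => 1 / (n : ℝ) * u n) atTop (𝓝 0)) {n : ℕ} (hn : 1 ≤ n) :
    0 ≤ u n := by
  have hmul : ∀ k : ℕ, u ((k + 1) * n) ≤ (k + 1) * u n := by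
    intro k
    induction k with
    | zero => simp
    | succ k ih =>
      have := hu ((k + 1) * n) n
      rw [show (k + 1 + 1) * n = (k + 1) * n + n by ring]
      push_cast
      linarith
  have hn' : (0 : ℝ) < n := by exact_mod_cast hn
  have hsub : Tendsto (fun k : ℕ => (k + 1) * n) atTop atTop :=
    tendsto_atTop_mono (fun k => by simp only [id]; nlinarith) tendsto_id
  have key : 0 ≤ u n / n := by
    refine le_of_tendsto (hlim.comp hsub) (Eventually.of_forall fun k => ?_)
    have hk : (0 : ℝ) < k + 1 := by positivity
    simp only [Function.comp_apply]
    push_cast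
    rw [one_div_mul_eq_div, div_le_div_iff₀ (by positivity) hn']
    nlinarith [hmul k]
  by_contra! hlt
  exact absurd key (not_le.2 (div_neg_of_neg_of_pos hlt hn'))

/-- A weight on words that is multiplicative up to the factor `Q`. -/
structure IsQuasiMul {I : Type*} (w : List I → ℝ) (Q : ℝ) : Prop where
  one_le : 1 ≤ Q
  nonneg : ∀ i, 0 ≤ w i
  pos : ∀ i, i ≠ [] → 0 < w i
  le : ∀ i j, i ≠ [] → j ≠ [] → w (i ++ j) ≤ Q * (w i * w j)
  ge : ∀ i j, i ≠ [] → j ≠ [] → Q⁻¹ * (w i * w j) ≤ w (i ++ j)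

theorem ne_nil_of_mem_words {I : Type*} [Fintype I] {n : ℕ} (hn : 1 ≤ n) {w : List I}
    (hw : w ∈ words I n) : w ≠ [] := by
  rintro rfl
  rw [mem_words] at hw
  simp at hw
  omega

namespace IsQuasiMul

variable {I : Type*} [Fintype I] {w : List I → ℝ} {Q : ℝ}

theorem sum_le (hw : IsQuasiMul w Q) {n : ℕ} (hn : 1 ≤ n) {h : List I} (hh : h ≠ []) :
    ∑ v ∈ words I n, w (h ++ v) ≤ Q * (w h * ∑ v ∈ words I n, w v) := by
  rw [Finset.mul_sum, Finset.mul_sum]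
  exact Finset.sum_le_sum fun v hv => hw.le h v hh (ne_nil_of_mem_words hn hv)

theorem le_sum (hw : IsQuasiMul w Q) {n : ℕ} (hn : 1 ≤ n) {h : List I} (hh : h ≠ []) :
    Q⁻¹ * (w h * ∑ v ∈ words I n, w v) ≤ ∑ v ∈ words I n, w (h ++ v) := by
  rw [Finset.mul_sum, Finset.mul_sum]
  exact Finset.sum_le_sum fun v hv => hw.ge h v hh (ne_nil_of_mem_words hn hv)

theorem sum_add_le (hw : IsQuasiMul w Q) {m n : ℕ} (hm : 1 ≤ m) (hn : 1 ≤ n) :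
    ∑ v ∈ words I (m + n), w v ≤ Q * ((∑ v ∈ words I m, w v) * ∑ v ∈ words I n, w v) := by
  rw [sum_words_add, Finset.sum_mul, Finset.mul_sum]
  exact Finset.sum_le_sum fun v hv => hw.sum_le hn (ne_nil_of_mem_words hm hv)

theorem le_sum_add (hw : IsQuasiMul w Q) {m n : ℕ} (hm : 1 ≤ m) (hn : 1 ≤ n) :
    Q⁻¹ * ((∑ v ∈ words I m, w v) * ∑ v ∈ words I n, w v) ≤ ∑ v ∈ words I (m + n), w v := by
  rw [sum_words_add, Finset.sum_mul, Finset.mul_sum]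
  exact Finset.sum_le_sum fun v hv => hw.le_sum hn (ne_nil_of_mem_words hm hv)

variable [Nonempty I]

theorem sum_pos (hw : IsQuasiMul w Q) {n : ℕ} (hn : 1 ≤ n) : 0 < ∑ v ∈ words I n, w v :=
  Finset.sum_pos (fun v hv => hw.pos v (ne_nil_of_mem_words hn hv)) (words_nonempty n)

/-- At zero pressure the sums over the words of a given length are bounded on both sides. -/
theorem sum_mem_Icc (hw : IsQuasiMul w Q)
    (hlim : Tendsto (fun n : ℕ => 1 / (n : ℝ) * Real.log (∑ v ∈ words I n, w v)) atTop (𝓝 0))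
    {n : ℕ} (hn : 1 ≤ n) : ∑ v ∈ words I n, w v ∈ Set.Icc Q⁻¹ Q := by
  set S : ℕ → ℝ := fun n => ∑ v ∈ words I n, w v with hSdef
  have hQ : 0 < Q := zero_lt_one.trans_le hw.one_le
  have hlogQ : 0 ≤ Real.log Q := Real.log_nonneg hw.one_le
  have hSpos : ∀ n, 1 ≤ n → 0 < S n := fun n hn => hw.sum_pos hn
  have hconst : Tendsto (fun n : ℕ => 1 / (n : ℝ) * Real.log Q) atTop (𝓝 0) := by
    simpa using tendsto_one_div_atTop_nhds_zero_nat.mul_const (Real.log Q)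
  have hup : ∀ m n, 1 ≤ m → 1 ≤ n →
      Real.log (S (m + n)) ≤ Real.log Q + (Real.log (S m) + Real.log (S n)) := by
    intro m n hm hn
    rw [← Real.log_mul (hSpos m hm).ne' (hSpos n hn).ne',
      ← Real.log_mul hQ.ne' (mul_pos (hSpos m hm) (hSpos n hn)).ne']
    exact Real.log_le_log (hSpos _ (by omega)) (hw.sum_add_le hm hn)
  have hlo : ∀ m n, 1 ≤ m → 1 ≤ n →
      -Real.log Q + (Real.log (S m) + Real.log (S n)) ≤ Real.log (S (m + n)) := by
    intro m n hm hn
    rw [← Real.log_mul (hSpos m hm).ne' (hSpos n hn).ne', ← Real.log_inv,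
      ← Real.log_mul (inv_pos.2 hQ).ne' (mul_pos (hSpos m hm) (hSpos n hn)).ne']
    exact Real.log_le_log
      (mul_pos (inv_pos.2 hQ) (mul_pos (hSpos m hm) (hSpos n hn))) (hw.le_sum_add hm hn)
  -- Both `log Q + log S` and `log Q - log S` are subadditive. The value at `0` is set to `0`
  -- because quasi-multiplicativity says nothing about the empty word.
  have key : ∀ ε : ℝ, (ε = 1 ∨ ε = -1) → 0 ≤ Real.log Q + ε * Real.log (S n) := by
    intro ε hε
    have := nonneg_of_subadditive_of_tendsto_zero
      (u := fun k => if k = 0 then 0 else Real.log Q + ε * Real.log (S k)) ?_ ?_ hn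
    · rwa [if_neg (by omega)] at this
    · intro k l
      rcases Nat.eq_zero_or_pos k with rfl | hk
      · simp
      rcases Nat.eq_zero_or_pos l with rfl | hl
      · simp
      simp only [show k + l ≠ 0 by omega, hk.ne', hl.ne', if_false]
      have h1 := hup k l hk hl
      have h2 := hlo k l hk hl
      rcases hε with rfl | rfl <;> linarith
    · have h3 := hconst.add (hlim.const_mul ε)
      rw [mul_zero, add_zero] at h3
      refine h3.congr fun k => ?_
      by_cases hk : k = 0
      · simp [hk]
      · simp only [hk, if_false]
        ring
  have h1 := key 1 (Or.inl rfl)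
  have h2 := key (-1) (Or.inr rfl)
  constructor
  · rw [← Real.log_le_log_iff (inv_pos.2 hQ) (hSpos n hn), Real.log_inv]
    linarith
  · rw [← Real.log_le_log_iff (hSpos n hn) hQ]
    linarith

/-- At zero pressure there is a mass distribution comparable with the weight. -/
theorem exists_mass (hw : IsQuasiMul w Q)
    (hlim : Tendsto (fun n : ℕ => 1 / (n : ℝ) * Real.log (∑ v ∈ words I n, w v)) atTop (𝓝 0)) :
    ∃ μ : List I → ℝ, (∀ h, h ≠ [] → (Q ^ 2)⁻¹ * w h ≤ μ h ∧ μ h ≤ Q ^ 2 * w h) ∧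
      ∀ h, h ≠ [] → ∀ S : Finset (List I), PrefixFree S → ∑ i ∈ S, μ (h ++ i) ≤ μ h := by
  have hQ : 0 < Q := zero_lt_one.trans_le hw.one_le
  -- One factor `Q` comes from splitting off `h`, the other from the level sum; the level must
  -- exceed the length of `h` for the remaining word to be nonempty.
  have hbd : ∀ h, h ≠ [] → ∀ n, h.length + 1 ≤ n →
      extSum w n h ∈ Set.Icc ((Q ^ 2)⁻¹ * w h) (Q ^ 2 * w h) := by
    intro h hh n hn
    obtain ⟨k, rfl⟩ := Nat.exists_eq_add_of_le hn
    have hk : 1 ≤ 1 + k := by omega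
    rw [add_assoc, extSum_eq]
    obtain ⟨h1, h2⟩ := hw.sum_mem_Icc hlim hk
    constructor
    · refine le_trans ?_ (hw.le_sum hk hh)
      calc (Q ^ 2)⁻¹ * w h = Q⁻¹ * (w h * Q⁻¹) := by rw [sq, mul_inv]; ring
        _ ≤ _ := by gcongr; exact hw.nonneg h
    · refine (hw.sum_le hk hh).trans ?_
      calc _ ≤ Q * (w h * Q) := by gcongr; exact hw.nonneg h
        _ = _ := by ring
  -- A limit along one ultrafilter serves all `h` at once and preserves finite sums and
  -- inequalities.
  have hex : ∀ h, h ≠ [] → ∃ a ∈ Set.Icc ((Q ^ 2)⁻¹ * w h) (Q ^ 2 * w h),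
      Tendsto (fun n => extSum w n h) (hyperfilter ℕ) (𝓝 a) := by
    intro h hh
    have := (isCompact_Icc (a := (Q ^ 2)⁻¹ * w h) (b := Q ^ 2 * w h)).ultrafilter_le_nhds
      ((hyperfilter ℕ).map fun n => extSum w n h) ?_
    · exact this
    · rw [le_principal_iff]
      have : ∀ᶠ n in (hyperfilter ℕ : Filter ℕ),
          extSum w n h ∈ Set.Icc ((Q ^ 2)⁻¹ * w h) (Q ^ 2 * w h) :=
        Nat.hyperfilter_le_atTop ((eventually_ge_atTop (h.length + 1)).mono (hbd h hh))
      exact this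
  choose! μ hμ hμlim using hex
  refine ⟨μ, hμ, fun h hh S hS => ?_⟩
  have hne : ∀ i, h ++ i ≠ [] := fun i => by simp [hh]
  exact le_of_tendsto_of_tendsto (tendsto_finsetSum S fun i _ => hμlim (h ++ i) (hne i))
    (hμlim h hh) (Eventually.of_forall fun n => sum_extSum_le hw.nonneg n h hS)

end IsQuasiMul

/-! ### Cylinders and residual words -/

theorem initialWord_length {I : Type*} (ω : ℕ → I) (n : ℕ) : (initialWord ω n).length = n := by
  simp [initialWord]

theorem initialWord_prefix {I : Type*} (ω : ℕ → I) {m n : ℕ} (h : m ≤ n) :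
    initialWord ω m <+: initialWord ω n := by
  obtain ⟨k, rfl⟩ := Nat.exists_eq_add_of_le h
  refine ⟨List.ofFn fun j : Fin k => ω (m + j), ?_⟩
  simp only [initialWord]
  rw [List.ofFn_add]
  simp

theorem eq_initialWord_of_prefix {I : Type*} {ω : ℕ → I} {n : ℕ} {v : List I}
    (h : v <+: initialWord ω n) : v = initialWord ω v.length := by
  have hle : v.length ≤ n := by simpa [initialWord_length] using h.length_le
  have := List.prefix_of_prefix_length_le h (initialWord_prefix ω hle)
    (by rw [initialWord_length])
  exact this.eq_of_length (by rw [initialWord_length])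

/-- The points coded by an infinite word that starts with `h`. -/
def cylinder {I M : Type*} (X : List I → Set M) (h : List I) : Set M :=
  {x | ∃ ω : ℕ → I, initialWord ω h.length = h ∧ ∀ n, x ∈ X (initialWord ω (n + 1))}

theorem mem_of_prefix {I M : Type*} {X : List I → Set M} {x : M} {ω : ℕ → I}
    (hx : ∀ n, x ∈ X (initialWord ω (n + 1))) {v : List I} (hv : v ≠ []) {n : ℕ}
    (h : v <+: initialWord ω n) : x ∈ X v := by
  rw [eq_initialWord_of_prefix h]
  obtain ⟨k, hk⟩ := Nat.exists_eq_succ_of_ne_zero (mt List.length_eq_zero_iff.1 hv)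
  rw [hk]
  exact hx k

theorem cylinder_subset {I M : Type*} (X : List I → Set M) {h : List I} (hh : h ≠ []) :
    cylinder X h ⊆ X h := by
  rintro x ⟨ω, hω, hx⟩
  exact mem_of_prefix hx hh (n := h.length) (by rw [hω])

theorem limitSet_subset {I M : Type*} [Fintype I] (X : List I → Set M) (m : ℕ) :
    limitSet X ⊆ ⋃ h ∈ words I m, cylinder X h := by
  rintro x ⟨ω, hω⟩
  have hx : x ∈ ⋂ n : ℕ, X (initialWord ω (n + 1)) := by rw [hω]; rfl
  rw [Set.mem_iInter] at hx
  simp only [Set.mem_iUnion]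
  exact ⟨initialWord ω m, mem_words.2 (initialWord_length ω m), ω,
    by rw [initialWord_length], hx⟩

open Classical in
/-- The words of maximal length in `W` without a prefix in `W`. -/
noncomputable def residual {I : Type*} [Fintype I] (W : Finset (List I)) : Finset (List I) :=
  {j ∈ words I (W.sup List.length) | ∀ i ∈ W, ¬ i <+: j}

theorem mem_residual {I : Type*} [Fintype I] {W : Finset (List I)} {j : List I} :
    j ∈ residual W ↔ j.length = W.sup List.length ∧ ∀ i ∈ W, ¬ i <+: j := by
  simp [residual, mem_words]

theorem disjoint_residual {I : Type*} [Fintype I] (W : Finset (List I)) :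
    Disjoint W (residual W) :=
  Finset.disjoint_left.2 fun i hi hi' => (mem_residual.1 hi').2 i hi List.prefix_rfl

-- A residual word is at least as long as every word of `W`, so it can be a prefix of one only by
-- equality.
open Classical in
theorem PrefixFree.union_residual {I : Type*} [Fintype I] {W : Finset (List I)}
    (hW : PrefixFree W) : PrefixFree (W ∪ residual W) := by
  intro i hi j hj hij
  rcases Finset.mem_union.1 hi with hi | hi <;> rcases Finset.mem_union.1 hj with hj | hj
  · exact hW i hi j hj hij
  · exact absurd hij ((mem_residual.1 hj).2 i hi)
  · refine hij.eq_of_length (le_antisymm hij.length_le ?_)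
    rw [(mem_residual.1 hi).1]
    exact Finset.le_sup (f := List.length) hj
  · exact hij.eq_of_length ((mem_residual.1 hi).1.trans (mem_residual.1 hj).1.symm)

/-- Cut the code of a point, after `h`, at the maximal length in `W`: the resulting word either has
a prefix in `W` or is residual. -/
theorem cylinder_subset_union {I M : Type*} [Fintype I] (X : List I → Set M) {h : List I}
    (hh : h ≠ []) (W : Finset (List I)) :
    cylinder X h ⊆ (⋃ i ∈ W, X (h ++ i)) ∪ ⋃ j ∈ residual W, cylinder X (h ++ j) := by
  rintro x ⟨ω, hω, hx⟩
  obtain ⟨j, hj⟩ := initialWord_prefix ω (Nat.le_add_right h.length (W.sup List.length))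
  rw [hω] at hj
  have hlen : j.length = W.sup List.length := by
    have := congrArg List.length hj
    rw [initialWord_length, List.length_append] at this
    omega
  by_cases hW : ∀ i ∈ W, ¬ i <+: j
  · right
    simp only [Set.mem_iUnion]
    refine ⟨j, mem_residual.2 ⟨hlen, hW⟩, ω, ?_, hx⟩
    rw [List.length_append, hlen, hj]
  · left
    push Not at hW
    obtain ⟨i, hi, hij⟩ := hW
    simp only [Set.mem_iUnion]
    refine ⟨i, hi, mem_of_prefix hx (by simp [hh]) (n := h.length + W.sup List.length) ?_⟩
    rw [← hj]
    exact (List.prefix_append_right_inj h).2 hij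

/-! ### Hausdorff content and the iterated cover -/

/-- The `δ`-restricted `t`-dimensional Hausdorff content. -/
noncomputable def content {M : Type*} [MetricSpace M] (t δ : ℝ) : OuterMeasure M :=
  OuterMeasure.mkMetric'.pre (fun s => Metric.ediam s ^ t) (ENNReal.ofReal δ)

theorem content_le {M : Type*} [MetricSpace M] {t δ a : ℝ} (ht : 0 ≤ t) (ha : 0 ≤ a)
    (haδ : a ≤ δ) {s : Set M} (hs : ∀ x ∈ s, ∀ y ∈ s, dist x y ≤ a) :
    content t δ s ≤ ENNReal.ofReal (a ^ t) := by
  have hd := Metric.ediam_le_of_forall_dist_le hs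
  refine (OuterMeasure.mkMetric'.pre_le (hd.trans (ENNReal.ofReal_le_ofReal haδ))).trans ?_
  rw [← ENNReal.ofReal_rpow_of_nonneg ha ht]
  exact ENNReal.rpow_le_rpow hd ht

theorem hausdorffMeasure_le_of_content_le {M : Type*} [MetricSpace M] [MeasurableSpace M]
    [BorelSpace M] {t : ℝ} {s : Set M} {b : ENNReal} (h : ∀ δ : ℝ, 0 < δ → content t δ s ≤ b) :
    μH[t] s ≤ b := by
  rw [Measure.hausdorffMeasure, ← Measure.coe_toOuterMeasure, Measure.mkMetric_toOuterMeasure,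
    OuterMeasure.mkMetric, OuterMeasure.mkMetric', OuterMeasure.iSup_apply]
  refine iSup_le fun r => ?_
  rw [OuterMeasure.iSup_apply]
  refine iSup_le fun hr => ?_
  obtain ⟨δ, -, hδ, hδr⟩ := ENNReal.lt_iff_exists_real_btwn.1 hr
  exact (OuterMeasure.mkMetric'.mono_pre _ hδr.le s).trans (h δ (ENNReal.ofReal_pos.1 hδ))

section Cover

variable {I M : Type*} [Fintype I] [MetricSpace M] {X : List I → Set M} {t B K a η : ℝ}
  {μ : List I → ℝ} {W : Finset (List I)}

/-- Here `k` counts rounds. Each round covers the `W`-part by a single set at cost `a` per unit mass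
and leaves at most the proportion `1 - η` of the mass in residual cylinders; after the last round
each cylinder is covered by itself at cost `B` per unit mass. -/
theorem content_cylinder_le (ht : 0 ≤ t) (hbdd : ∀ i, i ≠ [] → Bornology.IsBounded (X i))
    (hanti : ∀ h j, h ≠ [] → Metric.diam (X (h ++ j)) ≤ Metric.diam (X h))
    (hμ0 : ∀ h, h ≠ [] → 0 ≤ μ h)
    (hμ : ∀ h, h ≠ [] → Metric.diam (X h) ^ t ≤ B * μ h)
    (hsuper : ∀ h, h ≠ [] → ∀ S : Finset (List I), PrefixFree S → ∑ i ∈ S, μ (h ++ i) ≤ μ h)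
    (hW : PrefixFree W) (hK : 0 ≤ K) (ha : 0 ≤ a) (hB : 0 ≤ B) (hη : η ≤ 1)
    (hdist : ∀ h, h ≠ [] → ∀ i ∈ W, ∀ j ∈ W, ∀ x ∈ X (h ++ i), ∀ y ∈ X (h ++ j),
      dist x y ≤ K * Metric.diam (X h))
    (hWa : ∀ h, h ≠ [] → (K * Metric.diam (X h)) ^ t ≤ a * ∑ i ∈ W, μ (h ++ i))
    (hWη : ∀ h, h ≠ [] → η * μ h ≤ ∑ i ∈ W, μ (h ++ i)) {δ : ℝ} (k : ℕ) :
    ∀ h, h ≠ [] → Metric.diam (X h) ≤ δ → K * Metric.diam (X h) ≤ δ →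
      content t δ (cylinder X h) ≤ ENNReal.ofReal ((a + B * (1 - η) ^ k) * μ h) := by
  classical
  induction k with
  | zero =>
    intro h hh hδ _
    refine (measure_mono (cylinder_subset X hh)).trans
      ((content_le ht Metric.diam_nonneg hδ fun x hx y hy =>
        Metric.dist_le_diam_of_mem (hbdd h hh) hx hy).trans (ENNReal.ofReal_le_ofReal ?_))
    have := mul_nonneg ha (hμ0 h hh)
    rw [pow_zero]
    linarith [hμ h hh]
  | succ k ih =>
    intro h hh hδ hKδ
    have hne : ∀ j, h ++ j ≠ [] := fun j => by simp [hh]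
    have hη' : 0 ≤ 1 - η := sub_nonneg.2 hη
    have hq : 0 ≤ B * (1 - η) ^ k := by positivity
    have h1 : content t δ (⋃ i ∈ W, X (h ++ i)) ≤
        ENNReal.ofReal (a * ∑ i ∈ W, μ (h ++ i)) := by
      refine (content_le ht (mul_nonneg hK Metric.diam_nonneg) hKδ ?_).trans
        (ENNReal.ofReal_le_ofReal (hWa h hh))
      intro x hx y hy
      simp only [Set.mem_iUnion] at hx hy
      obtain ⟨i, hi, hx⟩ := hx
      obtain ⟨j, hj, hy⟩ := hy
      exact hdist h hh i hi j hj x hx y hy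
    have h2 : content t δ (⋃ j ∈ residual W, cylinder X (h ++ j)) ≤
        ENNReal.ofReal ((a + B * (1 - η) ^ k) * ∑ j ∈ residual W, μ (h ++ j)) := by
      refine (measure_biUnion_finset_le _ _).trans ?_
      rw [Finset.mul_sum, ENNReal.ofReal_sum_of_nonneg fun j _ =>
        mul_nonneg (by linarith) (hμ0 _ (hne j))]
      refine Finset.sum_le_sum fun j _ => ih _ (hne j) ((hanti h j hh).trans hδ) ?_
      exact (mul_le_mul_of_nonneg_left (hanti h j hh) hK).trans hKδ
    have hsum := hsuper h hh _ hW.union_residual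
    rw [Finset.sum_union (disjoint_residual W)] at hsum
    have hW0 : 0 ≤ ∑ i ∈ W, μ (h ++ i) := Finset.sum_nonneg fun i _ => hμ0 _ (hne i)
    have hV0 : 0 ≤ ∑ i ∈ residual W, μ (h ++ i) := Finset.sum_nonneg fun i _ => hμ0 _ (hne i)
    have hWh := hWη h hh
    refine (measure_mono (cylinder_subset_union X hh W)).trans
      ((measure_union_le _ _).trans ((add_le_add h1 h2).trans ?_))
    rw [← ENNReal.ofReal_add (mul_nonneg ha hW0) (mul_nonneg (by linarith) hV0)]
    refine ENNReal.ofReal_le_ofReal ?_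
    have e1 := mul_le_mul_of_nonneg_left hsum ha
    -- Only the residual mass carries the error term, which gains the factor `1 - η`.
    have e2 := mul_le_mul_of_nonneg_left
      (show ∑ i ∈ residual W, μ (h ++ i) ≤ (1 - η) * μ h by linarith) hq
    rw [pow_succ]
    linarith

theorem hausdorffMeasure_limitSet_le [MeasurableSpace M] [BorelSpace M] {b : ℝ} (ht : 0 ≤ t)
    (hbdd : ∀ i, i ≠ [] → Bornology.IsBounded (X i))
    (hanti : ∀ h j, h ≠ [] → Metric.diam (X (h ++ j)) ≤ Metric.diam (X h))
    (hsmall : ∀ ε : ℝ, 0 < ε → ∃ m, 1 ≤ m ∧ ∀ h ∈ words I m, Metric.diam (X h) < ε)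
    (hμ0 : ∀ h, h ≠ [] → 0 ≤ μ h)
    (hμ : ∀ h, h ≠ [] → Metric.diam (X h) ^ t ≤ B * μ h)
    (hμb : ∀ m, 1 ≤ m → ∑ h ∈ words I m, μ h ≤ b)
    (hsuper : ∀ h, h ≠ [] → ∀ S : Finset (List I), PrefixFree S → ∑ i ∈ S, μ (h ++ i) ≤ μ h)
    (hW : PrefixFree W) (hK : 0 ≤ K) (ha : 0 ≤ a) (hB : 0 ≤ B) (hη : η ≤ 1) (hη0 : 0 < η)
    (hdist : ∀ h, h ≠ [] → ∀ i ∈ W, ∀ j ∈ W, ∀ x ∈ X (h ++ i), ∀ y ∈ X (h ++ j),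
      dist x y ≤ K * Metric.diam (X h))
    (hWa : ∀ h, h ≠ [] → (K * Metric.diam (X h)) ^ t ≤ a * ∑ i ∈ W, μ (h ++ i))
    (hWη : ∀ h, h ≠ [] → η * μ h ≤ ∑ i ∈ W, μ (h ++ i)) :
    μH[t] (limitSet X) ≤ ENNReal.ofReal (a * b) := by
  refine hausdorffMeasure_le_of_content_le fun δ hδ => ?_
  -- Dividing by `K + 1` keeps both `diam` and `K * diam` below `δ`.
  obtain ⟨m, hm, hmδ⟩ := hsmall (δ / (K + 1)) (by positivity)
  have hcyl : ∀ h ∈ words I m, content t δ (cylinder X h) ≤ ENNReal.ofReal (a * μ h) := by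
    intro h hh
    have hne := ne_nil_of_mem_words hm hh
    have hd := (lt_div_iff₀ (by positivity : 0 < K + 1)).1 (hmδ h hh)
    have hd0 : 0 ≤ Metric.diam (X h) := Metric.diam_nonneg
    have hKd : 0 ≤ K * Metric.diam (X h) := mul_nonneg hK hd0
    have hlim : Tendsto (fun k : ℕ => ENNReal.ofReal ((a + B * (1 - η) ^ k) * μ h)) atTop
        (𝓝 (ENNReal.ofReal ((a + B * 0) * μ h))) := by
      refine ENNReal.tendsto_ofReal (((tendsto_const_nhds.add
        ((tendsto_pow_atTop_nhds_zero_of_lt_one ?_ ?_).const_mul B))).mul_const _)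
      · linarith
      · linarith
    rw [mul_zero, add_zero] at hlim
    refine ge_of_tendsto' hlim fun k => ?_
    exact content_cylinder_le ht hbdd hanti hμ0 hμ hsuper hW hK ha hB hη hdist hWa hWη k h hne
      (by linarith) (by linarith)
  refine (measure_mono (limitSet_subset X m)).trans ((measure_biUnion_finset_le _ _).trans
    ((Finset.sum_le_sum hcyl).trans ?_))
  rw [← ENNReal.ofReal_sum_of_nonneg fun h hh =>
    mul_nonneg ha (hμ0 h (ne_nil_of_mem_words hm hh)), ← Finset.mul_sum]
  exact ENNReal.ofReal_le_ofReal (mul_le_mul_of_nonneg_left (hμb m hm) ha)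

end Cover

/-! ### Diameters in a controlled Moran construction -/

theorem IsCMC.append_subset {I M : Type*} [MetricSpace M] {X : List I → Set M} (hX : IsCMC X)
    {h : List I} (hh : h ≠ []) (j : List I) : X (h ++ j) ⊆ X h := by
  induction j using List.reverseRecOn with
  | nil => simp
  | append_singleton j a ih =>
    have hl := List.length_pos_of_ne_nil hh
    have := hX.subset (h ++ (j ++ [a])) (by simp; omega)
    rw [← List.append_assoc, List.dropLast_concat] at this
    rw [← List.append_assoc]
    exact this.trans ih

theorem IsCMC.diam_append_le {I M : Type*} [MetricSpace M] {X : List I → Set M} (hX : IsCMC X)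
    (h j : List I) (hh : h ≠ []) : Metric.diam (X (h ++ j)) ≤ Metric.diam (X h) :=
  Metric.diam_mono (hX.append_subset hh j) (hX.isCompact h hh).isBounded

/-- The diameters are multiplicative up to the factor `D`. -/
def DiamControl {I M : Type*} [MetricSpace M] (X : List I → Set M) (D : ℝ) : Prop :=
  ∀ i j : List I, i ≠ [] → j ≠ [] →
    D⁻¹ * (Metric.diam (X i) * Metric.diam (X j)) ≤ Metric.diam (X (i ++ j)) ∧
    Metric.diam (X (i ++ j)) ≤ D * (Metric.diam (X i) * Metric.diam (X j))

theorem IsCMC.exists_diamControl {I M : Type*} [MetricSpace M] {X : List I → Set M}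
    (hX : IsCMC X) : ∃ D : ℝ, 1 ≤ D ∧
      (∃ n : ℕ, 1 ≤ n ∧ ∀ i : List I, i.length = n → Metric.diam (X i) < D⁻¹) ∧
      DiamControl X D := by
  obtain ⟨D, hD, hn, h⟩ := hX.control
  refine ⟨D, hD, hn, fun i j hi hj => ?_⟩
  have hpos := mul_pos (hX.diam_pos i hi) (hX.diam_pos j hj)
  obtain ⟨h1, h2⟩ := h i j hi hj
  exact ⟨(le_div_iff₀ hpos).1 h1, (div_le_iff₀ hpos).1 h2⟩

theorem IsCMC.isQuasiMul {I M : Type*} [MetricSpace M] {X : List I → Set M} (hX : IsCMC X)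
    {D t : ℝ} (hD : 1 ≤ D) (hc : DiamControl X D) (ht : 0 ≤ t) :
    IsQuasiMul (fun i => Metric.diam (X i) ^ t) (D ^ t) where
  one_le := Real.one_le_rpow hD ht
  nonneg i := Real.rpow_nonneg Metric.diam_nonneg t
  pos i hi := Real.rpow_pos_of_pos (hX.diam_pos i hi) t
  le i j hi hj := by
    have hi' := Metric.diam_nonneg (s := X i)
    have hj' := Metric.diam_nonneg (s := X j)
    rw [← Real.mul_rpow hi' hj', ← Real.mul_rpow (by linarith) (mul_nonneg hi' hj')]
    exact Real.rpow_le_rpow Metric.diam_nonneg (hc i j hi hj).2 ht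
  ge i j hi hj := by
    have hi' := Metric.diam_nonneg (s := X i)
    have hj' := Metric.diam_nonneg (s := X j)
    have hD' : 0 ≤ D⁻¹ := inv_nonneg.2 (by linarith)
    rw [← Real.mul_rpow hi' hj', ← Real.inv_rpow (by linarith),
      ← Real.mul_rpow hD' (mul_nonneg hi' hj')]
    exact Real.rpow_le_rpow (mul_nonneg hD' (mul_nonneg hi' hj')) (hc i j hi hj).1 ht

/-- `D * diam` is submultiplicative and at most `ρ < 1` on level `n`, so it decays geometrically
along the multiples of `n`. -/
theorem exists_diam_lt {I M : Type*} [Fintype I] [Nonempty I] [MetricSpace M]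
    {X : List I → Set M} {D : ℝ} (hD : 1 ≤ D) (hc : DiamControl X D) {n : ℕ} (hn : 1 ≤ n)
    (hsmall : ∀ i : List I, i.length = n → Metric.diam (X i) < D⁻¹) {ε : ℝ} (hε : 0 < ε) :
    ∃ m, 1 ≤ m ∧ ∀ h ∈ words I m, Metric.diam (X h) < ε := by
  have hD0 : 0 < D := by linarith
  obtain ⟨i₀, hi₀, hmax⟩ := (words I n).exists_max_image (fun i => Metric.diam (X i))
    (words_nonempty n)
  set ρ := D * Metric.diam (X i₀) with hρ
  have hρ0 : 0 ≤ ρ := mul_nonneg hD0.le Metric.diam_nonneg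
  have hρ1 : ρ < 1 := by
    have := mul_lt_mul_of_pos_left (hsmall i₀ (mem_words.1 hi₀)) hD0
    rwa [mul_inv_cancel₀ hD0.ne'] at this
  have hpow : ∀ k : ℕ, ∀ h : List I, h.length = (k + 1) * n →
      D * Metric.diam (X h) ≤ ρ ^ (k + 1) := by
    intro k
    induction k with
    | zero =>
      intro h hh
      rw [zero_add, pow_one]
      exact mul_le_mul_of_nonneg_left (hmax h (mem_words.2 (by simpa using hh))) hD0.le
    | succ k ih =>
      intro h hh
      have hlen : n ≤ h.length := by rw [hh]; nlinarith
      have hl1 : (h.take n).length = n := by simpa using hlen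
      have hl2 : (h.drop n).length = (k + 1) * n := by
        rw [List.length_drop, hh, Nat.sub_eq_iff_eq_add (by rw [← hh]; exact hlen)]
        ring
      have hne : ∀ l : List I, 1 ≤ l.length → l ≠ [] := by
        rintro _ hl rfl
        simp at hl
      have h1 := (hc (h.take n) (h.drop n) (hne _ (by omega)) (hne _ (by nlinarith))).2
      rw [List.take_append_drop] at h1
      calc D * Metric.diam (X h)
          ≤ D * (D * (Metric.diam (X (h.take n)) * Metric.diam (X (h.drop n)))) :=
            mul_le_mul_of_nonneg_left h1 hD0.le
        _ = (D * Metric.diam (X (h.take n))) * (D * Metric.diam (X (h.drop n))) := by ring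
        _ ≤ ρ * ρ ^ (k + 1) := by
            refine mul_le_mul ?_ (ih _ hl2) (mul_nonneg hD0.le Metric.diam_nonneg) hρ0
            exact mul_le_mul_of_nonneg_left (hmax _ (mem_words.2 hl1)) hD0.le
        _ = ρ ^ (k + 1 + 1) := by ring
  obtain ⟨k, hk⟩ := exists_pow_lt_of_lt_one hε hρ1
  refine ⟨(k + 1) * n, by nlinarith, fun h hh => ?_⟩
  have h1 := hpow k h (mem_words.1 hh)
  have h2 : ρ ^ (k + 1) ≤ ρ ^ k := pow_le_pow_of_le_one hρ0 hρ1.le (Nat.le_succ k)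
  have h3 : Metric.diam (X h) ≤ D * Metric.diam (X h) :=
    le_mul_of_one_le_left Metric.diam_nonneg hD
  linarith

theorem ne_nil_of_mem_Z {I M : Type*} [MetricSpace M] {X : List I → Set M} {r : ℝ} {i : List I}
    (hi : i ∈ Z X r) : i ≠ [] := by
  rintro rfl
  simpa using hi.1

/-- Restoring the last letter to `i.dropLast`, whose diameter exceeds `r`, costs at most a constant
factor. -/
theorem exists_mul_le_diam_of_mem_Z {I M : Type*} [Fintype I] [Nonempty I] [MetricSpace M]
    {X : List I → Set M} (hX : IsCMC X) {D : ℝ} (hD : 1 ≤ D) (hc : DiamControl X D) :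
    ∃ c : ℝ, 0 < c ∧ ∀ r : ℝ, 0 < r → ∀ i ∈ Z X r, c * r ≤ Metric.diam (X i) := by
  have hD0 : 0 < D := by linarith
  obtain ⟨a₀, ha₀⟩ := Finite.exists_min fun a : I => Metric.diam (X [a])
  have hpos := hX.diam_pos [a₀] (by simp)
  refine ⟨D⁻¹ * Metric.diam (X [a₀]), by positivity, fun r hr i hi => ?_⟩
  have hne := ne_nil_of_mem_Z hi
  have hdrop : i.dropLast ≠ [] := by
    intro h
    have h1 := congrArg List.length h
    have h2 := hi.1
    simp at h1
    omega
  have h1 := (hc i.dropLast [i.getLast hne] hdrop (by simp)).1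
  rw [List.dropLast_append_getLast] at h1
  refine le_trans ?_ h1
  rw [mul_assoc, mul_comm (Metric.diam (X [a₀]))]
  refine mul_le_mul_of_nonneg_left ?_ (inv_nonneg.2 hD0.le)
  exact mul_le_mul hi.2.2.le (ha₀ _) hpos.le Metric.diam_nonneg

/-- If `i` were a proper prefix of `j`, then `X j.dropLast ⊆ X i` would have diameter at most `r`.
-/
theorem prefixFree_of_subset_Z {I M : Type*} [MetricSpace M] {X : List I → Set M} (hX : IsCMC X)
    {r : ℝ} {W : Finset (List I)} (hW : ∀ i ∈ W, i ∈ Z X r) : PrefixFree W := by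
  rintro i hi j hj ⟨u, rfl⟩
  by_contra hne
  have hu : u ≠ [] := by
    rintro rfl
    simp at hne
  have h1 := (hW _ hj).2.2
  rw [List.dropLast_append_of_ne_nil hu] at h1
  have h2 := hX.diam_append_le i u.dropLast (ne_nil_of_mem_Z (hW i hi))
  linarith [(hW i hi).2.1]

theorem dist_le_diam_add_setDist {M : Type*} [MetricSpace M] {A B : Set M}
    (hA : Bornology.IsBounded A) (hB : Bornology.IsBounded B) {x y : M} (hx : x ∈ A)
    (hy : y ∈ B) : dist x y ≤ Metric.diam A + setDist A B + Metric.diam B := by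
  have : dist x y - Metric.diam A - Metric.diam B ≤ setDist A B := by
    refine le_csInf ⟨_, Set.mem_image2_of_mem hx hy⟩ ?_
    rintro _ ⟨a, ha, b, hb, rfl⟩
    have h1 := Metric.dist_le_diam_of_mem hA hx ha
    have h2 := Metric.dist_le_diam_of_mem hB hb hy
    have h3 := dist_triangle4 x a b y
    linarith
  linarith

theorem setDist_le {M : Type*} [MetricSpace M] {A B : Set M} {x y : M} (hx : x ∈ A)
    (hy : y ∈ B) : setDist A B ≤ dist x y := by
  refine csInf_le ⟨0, ?_⟩ (Set.mem_image2_of_mem hx hy)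
  rintro _ ⟨a, -, b, -, rfl⟩
  exact dist_nonneg

/-! ### Clusters and the conclusion -/

/-- Large clusters of words in `Z(r)` whose sets are close together force the limit set to have
small Hausdorff measure. -/
theorem exists_card_mul_hausdorffMeasure_le {I M : Type*} [Fintype I] [Nonempty I]
    [MetricSpace M] [MeasurableSpace M] [BorelSpace M] {X : List I → Set M} (hX : IsCMC X)
    (hT : IsTractable X) {t : ℝ} (ht : 0 ≤ t) (hP : HasPressure X t 0) :
    ∃ A : ℝ, ∀ r : ℝ, 0 < r → ∀ W : Finset (List I), (∀ i ∈ W, i ∈ Z X r) →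
      (∀ i ∈ W, ∀ j ∈ W, setDist (X i) (X j) ≤ r) →
      W.card * μH[t] (limitSet X) ≤ ENNReal.ofReal A := by
  obtain ⟨D, hD, ⟨n, hn, hsmall⟩, hc⟩ := hX.exists_diamControl
  obtain ⟨C, hC, hT⟩ := hT
  obtain ⟨c, hc0, hcZ⟩ := exists_mul_le_diam_of_mem_Z hX hD hc
  have hD0 : 0 < D := by linarith
  have hw := hX.isQuasiMul hD hc ht
  have hlim : Tendsto (fun n : ℕ => 1 / (n : ℝ) *
      Real.log (∑ v ∈ words I n, Metric.diam (X v) ^ t)) atTop (𝓝 0) := by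
    simpa only [HasPressure, sum_words] using hP
  obtain ⟨μ, hμ, hsuper⟩ := hw.exists_mass hlim
  set Q := D ^ t with hQdef
  have hQ : 0 < Q := zero_lt_one.trans_le hw.one_le
  have hμpos : ∀ h, h ≠ [] → 0 < μ h := fun h hh =>
    lt_of_lt_of_le (mul_pos (by positivity) (hw.pos h hh)) (hμ h hh).1
  -- Cost over mass per word: `(2 * D + C) * r` bounds the diameter of the cluster relative to `X
  -- h`, `D⁻¹ * c * r` bounds each piece from below, and `Q ^ 2` compares `μ` with `diam^t`.
  set A : ℝ := Q ^ 2 * ((2 * D + C) * D / c) ^ t with hA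
  refine ⟨A * Q ^ 3, fun r hr W hWZ hWd => ?_⟩
  rcases W.eq_empty_or_nonempty with rfl | hWne
  · simp
  have hN : (0 : ℝ) < W.card := by exact_mod_cast hWne.card_pos
  have hlow : ∀ h, h ≠ [] → W.card * ((Q ^ 2)⁻¹ * (D⁻¹ * c * r * Metric.diam (X h)) ^ t) ≤
      ∑ i ∈ W, μ (h ++ i) := by
    intro h hh
    rw [← nsmul_eq_mul]
    refine Finset.card_nsmul_le_sum _ _ _ fun i hi => ?_
    refine le_trans ?_ (hμ (h ++ i) (by simp [hh])).1
    have hd : 0 ≤ Metric.diam (X h) := Metric.diam_nonneg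
    gcongr
    refine le_trans ?_ (hc h i hh (ne_nil_of_mem_Z (hWZ i hi))).1
    calc D⁻¹ * c * r * Metric.diam (X h) = D⁻¹ * (Metric.diam (X h) * (c * r)) := by ring
      _ ≤ _ := by gcongr; exact hcZ r hr i (hWZ i hi)
  set e : ℝ := W.card * ((Q ^ 2)⁻¹ * (D⁻¹ * c * r) ^ t) with he
  have he0 : 0 < e := by positivity
  -- The proportion `η` depends on `r` and `W`, but it does not enter the resulting bound.
  have hmain := hausdorffMeasure_limitSet_le (X := X) (t := t) (μ := μ) (W := W)
    (K := (2 * D + C) * r) (a := A / W.card) (B := Q ^ 2) (b := Q ^ 3)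
    (η := min 1 (e / Q ^ 2)) ht
    (fun i hi => (hX.isCompact i hi).isBounded) hX.diam_append_le
    (fun ε hε => exists_diam_lt hD hc hn hsmall hε) (fun h hh => (hμpos h hh).le)
    (fun h hh => (inv_mul_le_iff₀ (by positivity)).1 (hμ h hh).1) ?_ hsuper
    (prefixFree_of_subset_Z hX hWZ) (by positivity) (by positivity) (by positivity)
    (min_le_left _ _) (lt_min one_pos (by positivity)) ?_ ?_ ?_
  · calc (W.card : ENNReal) * μH[t] (limitSet X)
        ≤ W.card * ENNReal.ofReal (A / W.card * Q ^ 3) := by gcongr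
      _ = ENNReal.ofReal (A * Q ^ 3) := by
        rw [← ENNReal.ofReal_natCast, ← ENNReal.ofReal_mul hN.le]
        congr 1
        field_simp
  · intro m hm
    calc ∑ h ∈ words I m, μ h ≤ ∑ h ∈ words I m, Q ^ 2 * Metric.diam (X h) ^ t :=
          Finset.sum_le_sum fun h hh => (hμ h (ne_nil_of_mem_words hm hh)).2
      _ = Q ^ 2 * ∑ h ∈ words I m, Metric.diam (X h) ^ t := by rw [Finset.mul_sum]
      _ ≤ Q ^ 2 * Q := by gcongr; exact (hw.sum_mem_Icc hlim hm).2
      _ = Q ^ 3 := by ring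
  · intro h hh i hi j hj x hx y hy
    have hne : ∀ j, h ++ j ≠ [] := fun j => by simp [hh]
    have h1 := dist_le_diam_add_setDist (hX.isCompact _ (hne i)).isBounded
      (hX.isCompact _ (hne j)).isBounded hx hy
    have h2 := hT r hr h i j hh (hWZ i hi) (hWZ j hj) (hWd i hi j hj)
    have h3 : ∀ k ∈ W, Metric.diam (X (h ++ k)) ≤ D * (Metric.diam (X h) * r) := by
      intro k hk
      refine (hc h k hh (ne_nil_of_mem_Z (hWZ k hk))).2.trans ?_
      have := (hWZ k hk).2.1
      have hd : 0 ≤ Metric.diam (X h) := Metric.diam_nonneg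
      gcongr
    have h4 := h3 i hi
    have h5 := h3 j hj
    linarith
  · intro h hh
    have hd : 0 ≤ Metric.diam (X h) := Metric.diam_nonneg
    calc ((2 * D + C) * r * Metric.diam (X h)) ^ t
        = ((2 * D + C) * D / c * (D⁻¹ * c * r * Metric.diam (X h))) ^ t := by
          congr 1
          field_simp
      _ = A / W.card * (W.card * ((Q ^ 2)⁻¹ * (D⁻¹ * c * r * Metric.diam (X h)) ^ t)) := by
          rw [Real.mul_rpow (by positivity) (by positivity), hA]
          field_simp
      _ ≤ _ := by gcongr; exact hlow h hh
  · intro h hh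
    have hd : 0 ≤ Metric.diam (X h) := Metric.diam_nonneg
    refine le_trans ?_ (hlow h hh)
    calc min 1 (e / Q ^ 2) * μ h ≤ e / Q ^ 2 * (Q ^ 2 * Metric.diam (X h) ^ t) :=
          mul_le_mul (min_le_right _ _) (hμ h hh).2 (hμpos h hh).le (by positivity)
      _ = e * Metric.diam (X h) ^ t := by field_simp
      _ = _ := by
        rw [Real.mul_rpow (by positivity) hd, he]
        ring

/-- If close clusters of words in `Z(r)` have bounded size, so do the sets `Z(x, r)`. -/
theorem exists_encard_ZAt_le {I M : Type*} [MetricSpace M] (hM : IsDoubling M)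
    {X : List I → Set M} {n₀ : ℕ}
    (h : ∀ r : ℝ, 0 < r → ∀ W : Finset (List I), (∀ i ∈ W, i ∈ Z X r) →
      (∀ i ∈ W, ∀ j ∈ W, setDist (X i) (X j) ≤ r) → W.card ≤ n₀) :
    ∃ N : ℕ, ∀ x : M, ∀ r : ℝ, 0 < r → (ZAt X x r).encard ≤ N := by
  classical
  obtain ⟨κ, hκ⟩ := hM
  refine ⟨n₀ * κ, fun x r hr => ?_⟩
  by_contra! hlt
  -- `ZAt X x r` is not known to be finite, so the pigeonhole is applied to a subset with `n₀ * κ +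
  -- 1` elements.
  obtain ⟨F, hFsub, hF⟩ := Set.exists_subset_encard_eq (Order.add_one_le_of_lt hlt)
  have hfin : F.Finite := Set.finite_of_encard_eq_coe (k := n₀ * κ + 1) (by rw [hF]; norm_cast)
  lift F to Finset (List I) using hfin
  -- With radius `r / 2`, sets meeting the same small ball are within distance `r`, hence form a
  -- cluster.
  obtain ⟨s, hs, hcov⟩ := hκ x (r / 2) (by positivity)
  rw [mul_div_cancel₀ r two_ne_zero] at hcov
  have hy : ∀ i ∈ F, ∃ y ∈ s, ∃ p ∈ X i, dist p y < r / 2 := by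
    intro i hi
    obtain ⟨p, hp, hpx⟩ := (hFsub hi).2
    have := hcov hpx
    simp only [Set.mem_iUnion, Metric.mem_ball] at this
    obtain ⟨y, hy, hpy⟩ := this
    exact ⟨y, hy, p, hp, hpy⟩
  have : Nonempty M := ⟨x⟩
  choose! y hys p hp hpy using hy
  have hfib : ∀ b ∈ s, (F.filter fun i => y i = b).card ≤ n₀ := by
    intro b _
    refine h r hr _ (fun i hi => (hFsub (Finset.mem_filter.1 hi).1).1) fun i hi j hj => ?_
    obtain ⟨hi, hib⟩ := Finset.mem_filter.1 hi
    obtain ⟨hj, hjb⟩ := Finset.mem_filter.1 hj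
    have h1 := hpy i hi
    have h2 := hpy j hj
    rw [hib] at h1
    rw [hjb] at h2
    have h3 := dist_triangle_right (p i) (p j) b
    exact (setDist_le (hp i hi) (hp j hj)).trans (by linarith)
  have hcard := Finset.card_le_mul_card_image_of_maps_to hys n₀ hfib
  rw [Set.encard_coe_eq_coe_finsetCard] at hF
  have hF' : F.card = n₀ * κ + 1 := by exact_mod_cast hF
  have := hcard.trans (Nat.mul_le_mul_left n₀ hs)
  omega

end Moran

theorem mainTheorem7 {I M : Type*} [Fintype I] (hI : 2 ≤ Fintype.card I)
    [MetricSpace M] [MeasurableSpace M] [BorelSpace M] (hM : Moran.IsDoubling M)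
    (X : List I → Set M) (hX : Moran.IsCMC X) (hT : Moran.IsTractable X)
    (t : ℝ) (ht : 0 ≤ t) (hP : Moran.HasPressure X t 0)
    (hH : 0 < μH[t] (Moran.limitSet X)) :
    Moran.FiniteClustering X := by
  have : Nonempty I := Fintype.card_pos_iff.1 (by omega)
  obtain ⟨A, hA⟩ := Moran.exists_card_mul_hausdorffMeasure_le hX hT ht hP
  -- Infinite measure is allowed: the quotient is then `0`.
  obtain ⟨n₀, hn₀⟩ := ENNReal.exists_nat_gt
    (ENNReal.div_lt_top (ENNReal.ofReal_ne_top (r := A)) hH.ne').ne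
  obtain ⟨N, hN⟩ := Moran.exists_encard_ZAt_le hM (X := X) (n₀ := n₀) fun r hr W hW hd => by
    have h1 : (W.card : ENNReal) ≤ ENNReal.ofReal A / μH[t] (Moran.limitSet X) := by
      refine ENNReal.le_div_iff_mul_le (Or.inl hH.ne') (Or.inr ENNReal.ofReal_ne_top) |>.2 ?_
      exact hA r hr W hW hd
    exact_mod_cast (h1.trans_lt hn₀).le
  refine lt_of_le_of_lt (iSup₂_le fun x _ => ?_) (ENat.natCast_lt_top N)
  refine limsup_le_of_le (by isBoundedDefault) ?_
  filter_upwards [self_mem_nhdsWithin] with r hr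
  exact hN x r hr
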